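/- Conventions. A network is a finite acyclic directed multigraph whose nodes are sources $S$, intermediate nodes and receivers $T$ (no edge enters a source, no edge leaves a receiver), together with a surjective demand function $\tau:T\to S$. For integers $k,n\ge 1$, a $(k,n)$-code over an alphabet $\mathcal A$ assigns to each intermediate node $v$ a function $f_v$ from the product of the word sets of its in-neighbours to $\mathcal A^{n}$, and to each receiver such a function with values in $\mathcal A^{k}$; the source $s$ sends its message $x_s\in\mathcal A^{k}$ to all its out-neighbours, and every other node $v$ sends to all its out-neighbours the value of $f_v$ at the words that it receives. The code is a solution if, for all messages $(x_s)_{s\in S}$, every receiver $t$ obtains $x_{\tau(t)}$. For a finite field $\mathbb F$, a code over $\mathcal A=\mathbb F$ is linear if all the functions $f_v$ are $\mathbb F$-linear. A network $\mathcal N$ is linearly solvable over $\mathbb F$ if it has a linear $(k,k)$-solution over $\mathbb F$ for some $k\ge 1$, and its linear capacity over $\mathbb F$ is $$\mathrm C^{\mathbb F}_{\mathrm{linear}}(\mathcal N)=\sup\Bigl\{\tfrac kn : \mathcal N \text{ has a linear } (k,n)\text{-solution over } \mathbb F\Bigr\}\in[0,\infty].$$ Corollary. Let $P$ be a finite or co-finite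 set of primes (co-finite means that all but finitely many primes lie in $P$). There is a sequence of networks $(\mathcal N_P^k)_k$, depending only on $P$, such that for every finite field $\mathbb F$: 1. for every $k$, the network $\mathcal N_P^k$ is linearly solvable over $\mathbb F$ if and only if $\operatorname{char}\mathbb F\in P$; 2. if $\operatorname{char}\mathbb F\notin P$, then $\mathrm C^{\mathbb F}_{\mathrm{linear}}(\mathcal N_P^k)\to 0$ as $k\to\infty$. -/

import Mathlib

open scoped ENNReal

universe u

/-- The nodes of a network: source nodes, intermediate nodes and receiver nodes. -/
inductive Node (S I T : Type) : Type where
  | source (s : S) : Node S I T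
  | inter (i : I) : Node S I T
  | receiver (t : T) : Node S I T

/-- A network (in circuit representation): a finite acyclic directed multigraph, whose nodes are
sources, intermediate nodes and receivers, with a demand function from the receivers onto the
sources. Nothing enters a source, nothing leaves a receiver. -/
structure Network : Type 1 where
  Source : Type
  Inter : Type
  Receiver : Type
  Edge : Type
  finite_source : Finite Source
  finite_inter : Finite Inter
  finite_receiver : Finite Receiver
  finite_edge : Finite Edge
  tail : Edge → Node Source Inter Receiver
  head : Edge → Node Source Inter Receiver
  head_ne_source : ∀ e s, head e ≠ Node.source s
  tail_ne_receiver : ∀ e t, tail e ≠ Node.receiver t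
  acyclic : ∀ v, ¬ Relation.TransGen (fun u w => ∃ e, tail e = u ∧ head e = w) v v
  demand : Receiver → Source
  demand_surjective : Function.Surjective demand

namespace Network

/-- The nodes of `N`. -/
abbrev V (N : Network) : Type := Node N.Source N.Inter N.Receiver

/-- There is an edge from `u` to `w`. -/
def Adj (N : Network) (u w : N.V) : Prop := ∃ e, N.tail e = u ∧ N.head e = w

/-- The set `v⁻` of in-neighbours of `v`. -/
def InNbr (N : Network) (v : N.V) : Type := {w : N.V // N.Adj w v}

/-- The length of the word carried by a node under a `(k, n)`-code: sources and receivers carry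
`k`-tuples of symbols, intermediate nodes carry `n`-tuples. -/
def len (N : Network) (k n : ℕ) : N.V → ℕ
  | Node.source _ => k
  | Node.inter _ => n
  | Node.receiver _ => k

/-- The words that node `v` may carry under a `(k, n)`-code over the alphabet `A`. -/
abbrev Word (N : Network) (A : Type*) (k n : ℕ) (v : N.V) : Type _ := Fin (N.len k n v) → A

/-- What node `v` receives: one word from each in-neighbour. -/
abbrev Input (N : Network) (A : Type*) (k n : ℕ) (v : N.V) : Type _ :=
  ∀ w : N.InNbr v, N.Word A k n w.1

/-- A tuple of messages: one `k`-tuple of symbols for each source. -/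
abbrev Messages (N : Network) (A : Type*) (k : ℕ) : Type _ := N.Source → Fin k → A

/-- A `(k, n)`-network code over the alphabet `A`: an encoding function for each intermediate node
and a decoding function for each receiver (sources use the identity). -/
structure Code (N : Network) (A : Type*) (k n : ℕ) where
  encode : ∀ i : N.Inter, N.Input A k n (Node.inter i) → (Fin n → A)
  decode : ∀ t : N.Receiver, N.Input A k n (Node.receiver t) → (Fin k → A)

namespace Code

variable {N : Network} {A : Type*} {k n : ℕ}

/-- `g v x` is the word carried by node `v` when the sources emit `x`. As the network is finite and
acyclic, these recursive equations have exactly one solution (`existsUnique_isCarried`). -/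
structure IsCarried (c : N.Code A k n) (g : ∀ v : N.V, N.Messages A k → N.Word A k n v) :
    Prop where
  source : ∀ s x, g (Node.source s) x = x s
  inter : ∀ i x, g (Node.inter i) x = c.encode i (fun w => g w.1 x)
  receiver : ∀ t x, g (Node.receiver t) x = c.decode t (fun w => g w.1 x)

theorem existsUnique_isCarried (c : N.Code A k n) : ∃! g, c.IsCarried g := by
  have wf : WellFounded (Relation.TransGen N.Adj) := by
    have := N.finite_source
    have := N.finite_inter
    have := N.finite_receiver
    have : Finite N.V := by
      refine Finite.of_injective (β := N.Source ⊕ N.Inter ⊕ N.Receiver)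
        (fun v => match v with
          | Node.source s => Sum.inl s
          | Node.inter i => Sum.inr (Sum.inl i)
          | Node.receiver t => Sum.inr (Sum.inr t)) ?_
      rintro (_ | _ | _) (_ | _ | _) h <;> simp_all
    have : Std.Irrefl (Relation.TransGen N.Adj) := ⟨N.acyclic⟩
    exact Finite.wellFounded_of_trans_of_irrefl _
  let step : ∀ v : N.V, (∀ w, Relation.TransGen N.Adj w v → N.Messages A k → N.Word A k n w) →
      N.Messages A k → N.Word A k n v := fun v => match v with
    | Node.source s => fun _ x => x s
    | Node.inter i => fun G x => c.encode i (fun w => G w.1 (.single w.2) x)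
    | Node.receiver t => fun G x => c.decode t (fun w => G w.1 (.single w.2) x)
  refine ⟨wf.fix step, ⟨?_, ?_, ?_⟩, ?_⟩
  · intro s x; rw [wf.fix_eq]
  · intro i x; rw [wf.fix_eq]
  · intro t x; rw [wf.fix_eq]
  · intro g hg
    funext v
    induction v using wf.induction with
    | _ v ih =>
      rw [wf.fix_eq]
      funext x
      rcases v with s | i | t
      · exact hg.source s x
      · rw [hg.inter]
        exact congrArg _ (funext fun w => congrFun (ih w.1 (.single w.2)) x)
      · rw [hg.receiver]
        exact congrArg _ (funext fun w => congrFun (ih w.1 (.single w.2)) x)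

/-- The code is a solution: every receiver recovers the message that it demands. -/
def IsSolution (c : N.Code A k n) : Prop :=
  ∃ g, c.IsCarried g ∧ ∀ t x, g (Node.receiver t) x = x (N.demand t)

/-- The code is linear over the field `F`: all its functions are `F`-linear. -/
structure IsLinear {F : Type*} [Field F] (c : N.Code F k n) : Prop where
  encode : ∀ i, IsLinearMap F (c.encode i)
  decode : ∀ t, IsLinearMap F (c.decode t)

end Code

/-- The capacity of `N` over the alphabet `A` with respect to a class `D` of codes: the supremum of
the ratios `k / n` (`k, n ≥ 1`) such that there is a `(k, n)`-solution in `D` over `A`. -/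
noncomputable def capacity (N : Network) (A : Type*) (D : ∀ k n, N.Code A k n → Prop) : ℝ≥0∞ :=
  sSup {r | ∃ k n : ℕ, 0 < k ∧ 0 < n ∧ (∃ c : N.Code A k n, D k n c ∧ c.IsSolution) ∧
    r = (k : ℝ≥0∞) / (n : ℝ≥0∞)}

/-- The linear capacity of `N` over the field `F`. -/
noncomputable def linearCapacity (N : Network) (F : Type*) [Field F] : ℝ≥0∞ :=
  N.capacity F (fun _ _ c => c.IsLinear)

/-- `N` is (vector) linearly solvable over `F`: for some `k ≥ 1` there is a `(k, k)`-linear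
solution over `F`. -/
def LinearlySolvable (N : Network) (F : Type*) [Field F] : Prop :=
  ∃ k : ℕ, 0 < k ∧ ∃ c : N.Code F k k, c.IsLinear ∧ c.IsSolution

end Network

/-! Index coding reduces the problem to two matrices `A`, `B` indexed by the words of length `q + 1`
over `r` letters, with complementary off-diagonal zeros. Here `q` is the product of the primes in
`P`, or of those outside `P`. `B` has entry `|agreement u v| - 1`: it vanishes where the agreement
is 1, its diagonal is `q`, and it factors through `O(r)` dimensions. `A` factors through `O(r ^ (q -
1))` dimensions; if `q = 0` in `F`, its diagonal is `±1` and it vanishes off the diagonal wherever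
the agreement is not 1. A factored matrix that vanishes outside the side information yields a code
(`indexNetwork.linearlySolvable`). One that vanishes on the side information bounds the rate
(`indexNetwork.mul_card_le`). With one matrix as code and the other as obstruction, the rate is at
most the product of the two inner dimensions over `r ^ (q + 1)`, which is `O(1 / r)`. Swapping the
roles exchanges the cases `q = 0` and `q ≠ 0` in `F`. -/

/-! ### Linearity of the carried words -/

namespace Network.Code

variable {N : Network} {F : Type*} [Field F] {k n : ℕ} {c : N.Code F k n}
  {g : ∀ v : N.V, N.Messages F k → N.Word F k n v}

theorem IsCarried.isLinearMap_inter (hg : c.IsCarried g) (hc : c.IsLinear) {i : N.Inter}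
    (h : ∀ w, N.Adj w (.inter i) → IsLinearMap F (g w)) : IsLinearMap F (g (.inter i)) := by
  refine ⟨fun x y => ?_, fun a x => ?_⟩
  · rw [hg.inter, hg.inter, hg.inter]
    refine Eq.trans ?_ ((hc.encode i).map_add _ _)
    exact congrArg _ (funext fun w => (h w.1 w.2).map_add x y)
  · rw [hg.inter, hg.inter]
    refine Eq.trans ?_ ((hc.encode i).map_smul _ _)
    exact congrArg _ (funext fun w => (h w.1 w.2).map_smul a x)

theorem IsCarried.isLinearMap_source (hg : c.IsCarried g) (s : N.Source) :
    IsLinearMap F (g (.source s)) := by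
  refine ⟨fun x y => ?_, fun a x => ?_⟩
  · rw [hg.source, hg.source, hg.source]
    rfl
  · rw [hg.source, hg.source]
    rfl

/-- Several runs of one linear code are superposed: if the combination cancels on every incoming
edge, it cancels in the decoded word. -/
theorem IsCarried.sum_smul_receiver_eq_zero (hg : c.IsCarried g) (hc : c.IsLinear)
    {t : N.Receiver} {κ : Type*} [Fintype κ] (a : κ → F) (x : κ → N.Messages F k)
    (h : ∀ w, N.Adj w (.receiver t) → ∑ l, a l • g w (x l) = 0) :
    ∑ l, a l • g (.receiver t) (x l) = 0 := by
  let D := (hc.decode t).mk'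
  let y : κ → N.Input F k n (.receiver t) := fun l w => g w.1 (x l)
  have hD : ∀ l, a l • g (.receiver t) (x l) = D (a l • y l) := fun l =>
    (congrArg (a l • ·) (hg.receiver t (x l))).trans (D.map_smul (a l) (y l)).symm
  refine (Finset.sum_congr rfl fun l _ => hD l).trans ((map_sum D _ _).symm.trans ?_)
  refine (congrArg D (funext fun w => ?_)).trans (map_zero D)
  rw [Finset.sum_apply]
  exact h w.1 w.2

end Network.Code

/-! ### Index coding: codes and rate bounds from factored matrices -/

/-- The index coding network of the side information relation `R` on `V`: every message `v : V` is
seen by all broadcast nodes `i : ι`, and the receiver `u`, who demands the message `u`, hears all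
the broadcast nodes and knows the messages `v` with `R u v`. -/
def indexNetwork (V ι : Type) [Finite V] [Finite ι] (R : V → V → Prop) : Network where
  Source := V
  Inter := ι
  Receiver := V
  Edge := (V × ι) ⊕ (ι × V) ⊕ {p : V × V // R p.1 p.2}
  finite_source := inferInstance
  finite_inter := inferInstance
  finite_receiver := inferInstance
  finite_edge := inferInstance
  tail := Sum.elim (fun e => .source e.1) (Sum.elim (fun e => .inter e.1) fun e => .source e.1.2)
  head := Sum.elim (fun e => .inter e.2) (Sum.elim (fun e => .receiver e.2) fun e => .receiver e.1.1)
  head_ne_source := by rintro (e | e | e) s <;> simp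
  tail_ne_receiver := by rintro (e | e | e) s <;> simp
  acyclic := by
    let f : Node V ι V → ℕ := fun v => match v with
      | .source _ => 0
      | .inter _ => 1
      | .receiver _ => 2
    intro v hv
    have h := Relation.TransGen.lift (p := (· < ·)) f (by
      rintro a b ⟨e | e | e, rfl, rfl⟩ <;> simp [f, Function.onFun]) _ _ hv
    rw [Function.onFun, Relation.transGen_eq_self] at h
    exact lt_irrefl _ h
  demand := id
  demand_surjective := Function.surjective_id

namespace indexNetwork

variable {V ι : Type} [Finite V] [Finite ι] {R : V → V → Prop}

theorem adj_inter_iff {i : ι} {w : Node V ι V} :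
    (indexNetwork V ι R).Adj w (.inter i) ↔ ∃ v, w = .source v := by
  constructor
  · rintro ⟨e | e | e, h₁, h₂⟩
    · exact ⟨e.1, h₁.symm⟩
    · exact absurd h₂ (by simp [indexNetwork])
    · exact absurd h₂ (by simp [indexNetwork])
  · rintro ⟨v, rfl⟩
    exact ⟨.inl (v, i), rfl, rfl⟩

theorem adj_receiver_iff {u : V} {w : Node V ι V} :
    (indexNetwork V ι R).Adj w (.receiver u) ↔
      (∃ i, w = .inter i) ∨ ∃ v, R u v ∧ w = .source v := by
  constructor
  · rintro ⟨e | e | e, h₁, h₂⟩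
    · exact absurd h₂ (by simp [indexNetwork])
    · exact .inl ⟨e.1, h₁.symm⟩
    · have h : e.1.1 = u := by simpa [indexNetwork] using h₂
      exact .inr ⟨e.1.2, h ▸ e.2, h₁.symm⟩
  · rintro (⟨i, rfl⟩ | ⟨v, hv, rfl⟩)
    · exact ⟨.inr (.inl (i, u)), rfl, rfl⟩
    · exact ⟨.inr (.inr ⟨(u, v), hv⟩), rfl, rfl⟩

/-- If a matrix `X * Y` with non-zero diagonal vanishes at all pairs `u ≠ v` for which `u` does not
know the message `v`, then broadcasting `Y x` is a scalar linear solution. -/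
theorem linearlySolvable {F : Type*} [Field F] [Fintype V] [Fintype ι]
    (X : V → ι → F) (Y : ι → V → F) (hR : ∀ u, ¬ R u u)
    (hdiag : ∀ u, ∑ i, X u i * Y i u ≠ 0)
    (hoff : ∀ u v, u ≠ v → ¬ R u v → ∑ i, X u i * Y i v = 0) :
    (indexNetwork V ι R).LinearlySolvable F := by
  classical
  let N := indexNetwork V ι R
  let enc : ι → (V → F) → F := fun i x => ∑ v, Y i v * x v
  -- The broadcast gives `u` the sum `∑ v, (X * Y) u v * x v`. The terms of known messages are
  -- subtracted, unknown ones have coefficient zero, and the diagonal entry is divided out.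
  let dec : (u : V) → (ι → F) → ({v // R u v} → F) → F := fun u y x =>
    (∑ i, X u i * Y i u)⁻¹ * ((∑ i, X u i * y i) - ∑ v, (∑ i, X u i * Y i v.1) * x v)
  have enc_add : ∀ i x y, enc i (x + y) = enc i x + enc i y := fun i x y => by
    simp [enc, mul_add, Finset.sum_add_distrib]
  have enc_smul : ∀ i (a : F) x, enc i (a • x) = a • enc i x := fun i a x => by
    simp [enc, Finset.mul_sum, mul_left_comm]
  have dec_add : ∀ u y x y' x', dec u (y + y') (x + x') = dec u y x + dec u y' x' :=
    fun u y x y' x' => by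
      simp only [dec, Pi.add_apply, mul_add, Finset.sum_add_distrib]
      ring
  have dec_smul : ∀ u (a : F) y x, dec u (a • y) (a • x) = a • dec u y x := fun u a y x => by
    simp only [dec, Pi.smul_apply, smul_eq_mul, mul_left_comm _ a, ← Finset.mul_sum, ← mul_sub]
  have dec_enc : ∀ u (x : V → F), dec u (fun i => enc i x) (fun v => x v) = x u := by
    intro u x
    have h₁ : ∑ i, X u i * ∑ v, Y i v * x v = ∑ v, (∑ i, X u i * Y i v) * x v := by
      simp_rw [Finset.mul_sum, Finset.sum_mul, mul_assoc]
      exact Finset.sum_comm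
    have h₂ : ∑ v : {v // R u v}, (∑ i, X u i * Y i v.1) * x v.1 =
        ∑ v, if R u v then (∑ i, X u i * Y i v) * x v else 0 := by
      rw [← Finset.sum_filter]
      exact (Finset.sum_subtype _ (by simp) fun v => (∑ i, X u i * Y i v) * x v).symm
    have h₃ : (∑ i, X u i * Y i u) * x u =
        ∑ v, if u = v then (∑ i, X u i * Y i v) * x v else 0 := by simp
    simp only [dec, enc]
    rw [inv_mul_eq_iff_eq_mul₀ (hdiag u), sub_eq_iff_eq_add, h₁, h₂, h₃, ← Finset.sum_add_distrib]
    refine Finset.sum_congr rfl fun v _ => ?_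
    by_cases huv : u = v
    · subst huv
      simp [hR]
    · by_cases h : R u v
      · simp [huv, h]
      · simp [huv, h, hoff u v huv h]
  let c : N.Code F 1 1 :=
    { encode := fun i y _ => enc i fun v => y ⟨.source v, adj_inter_iff.2 ⟨v, rfl⟩⟩ (0 : Fin 1)
      decode := fun u y _ => dec u
        (fun i => y ⟨.inter i, adj_receiver_iff.2 (.inl ⟨i, rfl⟩)⟩ (0 : Fin 1))
        (fun v => y ⟨.source v.1, adj_receiver_iff.2 (.inr ⟨v.1, v.2, rfl⟩)⟩ (0 : Fin 1)) }
  let g : ∀ v : N.V, N.Messages F 1 → N.Word F 1 1 v := fun v => match v with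
    | .source s => fun x => x s
    | .inter i => fun x _ => enc i fun v => x v (0 : Fin 1)
    | .receiver u => fun x => x u
  refine ⟨1, one_pos, c, ⟨fun i => ⟨?_, ?_⟩, fun u => ⟨?_, ?_⟩⟩,
    g, ⟨fun _ _ => rfl, fun _ _ => rfl, fun u x => funext fun j => ?_⟩, fun _ _ => rfl⟩
  · exact fun y z => funext fun j => enc_add i _ _
  · exact fun a y => funext fun j => enc_smul i a _
  · exact fun y z => funext fun j => dec_add u _ _ _ _
  · exact fun a y => funext fun j => dec_smul u a _ _
  · obtain rfl : j = (0 : Fin 1) := Subsingleton.elim (α := Fin 1) _ _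
    exact (dec_enc u fun v => x v (0 : Fin 1)).symm

/-- If a matrix `α * β` with non-zero diagonal vanishes at all pairs `(u, v)` for which `u` knows
the message `v`, then the rate of a linear solution is bounded by the inner dimension of the
product, times the number of broadcast nodes, divided by the number of messages. -/
theorem mul_card_le {F : Type*} [Field F] [Fintype V] [Fintype ι] {κ : Type*} [Fintype κ]
    (α : V → κ → F) (β : κ → V → F)
    (hdiag : ∀ u, ∑ l, α u l * β l u ≠ 0)
    (hoff : ∀ u v, R u v → ∑ l, α u l * β l v = 0)
    {k n : ℕ} (c : (indexNetwork V ι R).Code F k n) (hlin : c.IsLinear) (hsol : c.IsSolution) :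
    k * Fintype.card V ≤ Fintype.card ι * Fintype.card κ * n := by
  obtain ⟨g, hg, hdec⟩ := hsol
  have hG : ∀ i : ι, IsLinearMap F (g (.inter i)) := fun i =>
    hg.isLinearMap_inter hlin fun w hw => by
      obtain ⟨v, rfl⟩ := adj_inter_iff.1 hw
      exact hg.isLinearMap_source v
  let G : ι → (V → Fin k → F) →ₗ[F] (Fin n → F) := fun i => (hG i).mk'
  -- One run of the code for each `l`, on the messages rescaled by `β l`; `L` records all broadcast
  -- words.
  let L : (V → Fin k → F) →ₗ[F] (κ → ι → Fin n → F) := LinearMap.pi fun l => LinearMap.pi fun i =>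
    G i ∘ₗ LinearMap.pi fun v => β l v • LinearMap.proj v
  have hL : Function.Injective L := by
    rw [← LinearMap.ker_eq_bot, LinearMap.ker_eq_bot']
    intro x hx
    funext u
    -- Combine the runs with weights `α u l`: the broadcasts vanish because `L x = 0`, the side
    -- information because of `hoff`. Hence so does the decoded word, a non-zero multiple of `x u`.
    have key : ∑ l, α u l • (β l u • x u) = 0 := by
      have h := hg.sum_smul_receiver_eq_zero hlin (t := u) (α u) (fun l v => β l v • x v) ?_
      · refine Eq.trans (Finset.sum_congr rfl fun l _ => ?_) h
        have h := hdec u fun v => β l v • x v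
        exact congrArg (α u l • ·) h.symm
      intro w hw
      obtain ⟨i, rfl⟩ | ⟨v, hv, rfl⟩ := adj_receiver_iff.1 hw
      · refine Finset.sum_eq_zero fun l _ => ?_
        exact (congrArg (α u l • ·) (congrFun (congrFun hx l) i)).trans (smul_zero _)
      · refine Eq.trans (Finset.sum_congr rfl fun l _ =>
          congrArg (α u l • ·) (hg.source v _)) ?_
        refine Eq.trans (b := ∑ l, α u l • (β l v • x v)) rfl ?_
        simp_rw [← mul_smul]
        rw [← Finset.sum_smul, hoff u v hv, zero_smul]
        rfl
    simp_rw [← mul_smul] at key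
    rw [← Finset.sum_smul] at key
    exact (smul_eq_zero.1 key).resolve_left (hdiag u)
  have h := LinearMap.finrank_le_finrank_of_injective hL
  simp only [Module.finrank_pi_fintype, Module.finrank_self, Finset.sum_const, Finset.card_univ,
    smul_eq_mul, Fintype.card_fin, mul_one] at h
  calc k * Fintype.card V = Fintype.card V * k := mul_comm _ _
    _ ≤ _ := h
    _ = _ := by ring

end indexNetwork

/-! ### The two matrices on words -/

/-- The sum is the derivative of `(1 - t) ^ |E|` at `t = 1`, which is non-zero only for `|E| = 1`.
-/
theorem sum_powerset_neg_one_pow_mul_card {α : Type*} (E : Finset α) (hE : E.card ≠ 1) :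
    ∑ J ∈ E.powerset, (-1 : ℤ) ^ J.card * J.card = 0 := by
  rw [Finset.sum_powerset_apply_card (fun m => (-1 : ℤ) ^ m * m)]
  rcases h : E.card with _ | b
  · simp
  · rw [Finset.sum_range_succ']
    have hb : b ≠ 0 := by rintro rfl; exact hE h
    have := Int.alternating_sum_range_choose_of_ne hb
    calc _ = -(b + 1 : ℤ) * ∑ m ∈ Finset.range (b + 1), (-1 : ℤ) ^ m * b.choose m := by
          rw [Finset.mul_sum]
          simp only [Nat.cast_zero, mul_zero, smul_zero, add_zero]
          refine Finset.sum_congr rfl fun m _ => ?_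
          have h := Nat.add_one_mul_choose_eq b m
          zify at h
          rw [nsmul_eq_mul]
          push_cast
          linear_combination (-1 : ℤ) ^ m * h
      _ = 0 := by rw [this, mul_zero]

/-- The set of coordinates at which the words `u` and `v` agree. -/
def agreement {s r : ℕ} (u v : Fin s → Fin r) : Finset (Fin s) := {i | u i = v i}

theorem agreement_self {s r : ℕ} (u : Fin s → Fin r) : agreement u u = Finset.univ := by
  simp [agreement]

theorem agreement_eq_univ {s r : ℕ} {u v : Fin s → Fin r} :
    agreement u v = Finset.univ ↔ u = v := by
  simp [agreement, Finset.filter_eq_self, funext_iff]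

/-- The partial words of length `s` over `Fin r` that are defined at fewer than `q` places. -/
abbrev PartialWord (q s r : ℕ) : Type :=
  Σ J : {J : Finset (Fin s) // J.card < q}, (J.1 → Fin r)

/-- The places and letters of words of length `s` over `Fin r`, and one extra element. -/
abbrev Letter (s r : ℕ) : Type := Option (Fin s × Fin r)

section

variable {F : Type*} [Field F] {q s r : ℕ}

/-- The incidence matrix of words and partial words. -/
noncomputable def incidence (F : Type*) [Field F] (u : Fin s → Fin r) (w : PartialWord q s r) : F :=
  if (fun j : w.1.1 => u j) = w.2 then 1 else 0

/-- The weighted incidence matrix of partial words and words. -/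
noncomputable def weightedIncidence (F : Type*) [Field F] (w : PartialWord q s r)
    (v : Fin s → Fin r) : F :=
  (-1) ^ w.1.1.card * w.1.1.card * incidence F v w

/-- A domain `J` contributes only if `u` and `v` have the same restriction to it, and then through
exactly one partial word. -/
theorem sum_incidence_mul (u v : Fin s → Fin r) :
    ∑ w : PartialWord q s r, incidence F u w * weightedIncidence F w v =
      ∑ J ∈ (agreement u v).powerset with J.card < q, (-1 : F) ^ J.card * J.card := by
  classical
  rw [Fintype.sum_sigma]
  have h : ∀ J : {J : Finset (Fin s) // J.card < q},
      ∑ w : J.1 → Fin r, incidence F u (⟨J, w⟩ : PartialWord q s r) * weightedIncidence F ⟨J, w⟩ v =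
        if J.1 ⊆ agreement u v then (-1 : F) ^ J.1.card * J.1.card else 0 := by
    intro J
    have hJ : (fun j : J.1 => u j) = (fun j : J.1 => v j) ↔ J.1 ⊆ agreement u v := by
      simp [funext_iff, Finset.subset_iff, agreement]
    simp only [incidence, weightedIncidence, ite_mul, one_mul, zero_mul, Finset.sum_ite_eq,
      Finset.mem_univ, if_true, hJ, mul_ite, mul_one, mul_zero]
  simp_rw [h]
  rw [← Finset.sum_subtype (p := fun J : Finset (Fin s) => J.card < q)
    (Finset.univ.filter fun J => J.card < q) (by simp)
    (fun J => if J ⊆ agreement u v then (-1 : F) ^ J.card * J.card else 0), ← Finset.sum_filter]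
  refine Finset.sum_congr ?_ fun _ _ => rfl
  ext J
  simp [and_comm]

/-- The untruncated alternating sum is zero, so the value is minus the terms with `|J| ≥ q`. Those
of size `q` carry the factor `q = 0`; the full set occurs only for `u = v`. -/
theorem sum_incidence_mul_add (hF : (q : F) = 0) (u v : Fin (q + 1) → Fin r)
    (huv : (agreement u v).card ≠ 1) :
    ∑ w : PartialWord q (q + 1) r, incidence F u w * weightedIncidence F w v =
      if u = v then (-1) ^ q else 0 := by
  classical
  have h₀ : ∑ J ∈ (agreement u v).powerset, (-1 : F) ^ J.card * J.card = 0 := by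
    have := congrArg (Int.cast : ℤ → F) (sum_powerset_neg_one_pow_mul_card _ huv)
    push_cast at this
    exact this
  rw [sum_incidence_mul, ← add_right_cancel_iff,
    Finset.sum_filter_add_sum_filter_not _ (fun J : Finset (Fin (q + 1)) => J.card < q), h₀]
  symm
  have h₁ : ∀ J ∈ (agreement u v).powerset.filter (fun J => ¬ J.card < q),
      (-1 : F) ^ J.card * J.card = if J = Finset.univ then (-1) ^ (q + 1) else 0 := by
    intro J hJ
    split_ifs with h
    · subst h
      simp [hF]
    · have h₂ : J.card < q + 1 := by
        simpa using Finset.card_lt_univ_of_notMem (x := _)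
          (by simpa [Finset.eq_univ_iff_forall] using h : ∃ x, x ∉ J).choose_spec
      have h₃ := (Finset.mem_filter.1 hJ).2
      rw [show J.card = q by omega, hF, mul_zero]
  rw [Finset.sum_congr rfl h₁, Finset.sum_ite_eq']
  have h₂ : Finset.univ ∈ (agreement u v).powerset.filter (fun J => ¬ J.card < q) ↔ u = v := by
    rw [Finset.mem_filter, Finset.mem_powerset, Finset.univ_subset_iff, agreement_eq_univ]
    simp
  simp only [h₂]
  split_ifs <;> ring

/-- The incidence matrix of words and letters, with a column of ones. -/
noncomputable def letterIncidence (F : Type*) [Field F] (u : Fin s → Fin r) : Letter s r → F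
  | none => 1
  | some (i, a) => if u i = a then 1 else 0

/-- The transposed incidence matrix of words and letters, with a row of entries `-1`. -/
noncomputable def signedLetterIncidence (F : Type*) [Field F] :
    Letter s r → (Fin s → Fin r) → F
  | none, _ => -1
  | some (i, a), v => if v i = a then 1 else 0

theorem sum_letterIncidence_mul (u v : Fin s → Fin r) :
    ∑ l, letterIncidence F u l * signedLetterIncidence F l v = (agreement u v).card - 1 := by
  simp [Fintype.sum_option, Fintype.sum_prod_type, letterIncidence, signedLetterIncidence,
    agreement, eq_comm]
  ring

end

/-! ### Inner dimensions against the number of words -/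

theorem card_partialWord_le (q s : ℕ) {r : ℕ} (hr : 0 < r) :
    Fintype.card (PartialWord (q + 1) s r) ≤ 2 ^ s * r ^ q := by
  rw [Fintype.card_sigma]
  calc _ ≤ ∑ _J : {J : Finset (Fin s) // J.card < q + 1}, r ^ q := by
        refine Finset.sum_le_sum fun J _ => ?_
        simpa using Nat.pow_le_pow_right hr (Nat.lt_succ_iff.1 J.2)
    _ ≤ _ := by
        rw [Finset.sum_const, smul_eq_mul]
        refine Nat.mul_le_mul_right _ ((Fintype.card_subtype_le _).trans ?_)
        simp

theorem card_letter_le (s : ℕ) {r : ℕ} (hr : 0 < r) :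
    Fintype.card (Letter s r) ≤ (s + 1) * r := by
  simp
  nlinarith

theorem card_mul_card_mul_le {q r : ℕ} (hq : 0 < q) (hr : 0 < r) :
    Fintype.card (PartialWord q (q + 1) r) * Fintype.card (Letter (q + 1) r) * r ≤
      2 ^ (q + 1) * (q + 2) * Fintype.card (Fin (q + 1) → Fin r) := by
  obtain ⟨q, rfl⟩ := Nat.exists_eq_succ_of_ne_zero hq.ne'
  calc _ ≤ (2 ^ (q + 1 + 1) * r ^ q) * ((q + 1 + 1 + 1) * r) * r :=
        Nat.mul_le_mul_right _
          (Nat.mul_le_mul (card_partialWord_le q _ hr) (card_letter_le _ hr))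
    _ = _ := by
        simp only [Fintype.card_pi, Finset.prod_const, Finset.card_univ, Fintype.card_fin,
          Nat.succ_eq_add_one]
        ring

/-- Strictness in `hK` matters for `K = 0`, where the capacity bound 1 alone would not exclude rate
1. -/
theorem indexNetwork.linearCapacity_le {V ι : Type} [Fintype V] [Fintype ι] {R : V → V → Prop}
    {F : Type*} [Field F] {κ : Type*} [Fintype κ] (α : V → κ → F) (β : κ → V → F)
    (hdiag : ∀ u, ∑ l, α u l * β l u ≠ 0)
    (hoff : ∀ u v, R u v → ∑ l, α u l * β l v = 0) {K : ℕ}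
    (hK : Fintype.card ι * Fintype.card κ * (K + 1) < Fintype.card V) :
    ¬ (indexNetwork V ι R).LinearlySolvable F ∧
      (indexNetwork V ι R).linearCapacity F ≤ ((K + 1 : ℕ) : ℝ≥0∞)⁻¹ := by
  have hV : 0 < Fintype.card V := hK.trans_le' (Nat.zero_le _)
  constructor
  · rintro ⟨k, hk, c, hlin, hsol⟩
    have h := mul_card_le α β hdiag hoff c hlin hsol
    rw [mul_comm] at h
    have := Nat.le_of_mul_le_mul_right h hk
    nlinarith
  · refine sSup_le ?_
    rintro _ ⟨k, n, hk, hn, ⟨c, hlin, hsol⟩, rfl⟩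
    have h := mul_card_le α β hdiag hoff c hlin hsol
    have h' : (K + 1) * k ≤ n := by
      refine Nat.le_of_mul_le_mul_right (c := Fintype.card V) ?_ hV
      calc (K + 1) * k * Fintype.card V = (K + 1) * (k * Fintype.card V) := mul_assoc _ _ _
        _ ≤ (K + 1) * (Fintype.card ι * Fintype.card κ * n) := Nat.mul_le_mul_left _ h
        _ = n * (Fintype.card ι * Fintype.card κ * (K + 1)) := by ring
        _ ≤ n * Fintype.card V := Nat.mul_le_mul_left _ hK.le
    refine ENNReal.div_le_of_le_mul ?_
    rw [← ENNReal.div_eq_inv_mul, ENNReal.le_div_iff_mul_le (by simp) (by simp)]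
    rw [mul_comm]
    exact_mod_cast h'

/-- The alphabet size for which the capacity of the `K`-th network is at most `1 / (K + 1)`. -/
def alphabetSize (q K : ℕ) : ℕ := (2 ^ (q + 1) * (q + 2) + 1) * (K + 1)

theorem card_mul_card_mul_lt {q : ℕ} (hq : 0 < q) (K : ℕ) :
    Fintype.card (PartialWord q (q + 1) (alphabetSize q K)) *
      Fintype.card (Letter (q + 1) (alphabetSize q K)) * (K + 1) <
        Fintype.card (Fin (q + 1) → Fin (alphabetSize q K)) := by
  have hr : 0 < alphabetSize q K := by unfold alphabetSize; positivity
  have h := card_mul_card_mul_le hq hr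
  have hV : 0 < Fintype.card (Fin (q + 1) → Fin (alphabetSize q K)) := by
    rw [Fintype.card_pi]
    exact Finset.prod_pos fun _ _ => by simpa using hr
  -- The extra 1 in this factor of `alphabetSize` makes the inequality strict.
  refine Nat.lt_of_mul_lt_mul_left (a := 2 ^ (q + 1) * (q + 2) + 1) ?_
  calc _ = _ * alphabetSize q K := by unfold alphabetSize; ring
    _ ≤ _ := h
    _ < _ := Nat.mul_lt_mul_of_pos_right (Nat.lt_succ_self _) hV

section

variable {F : Type*} [Field F] {q r : ℕ}

theorem sum_letterIncidence_mul_self_ne_zero (hF : (q : F) ≠ 0) (u : Fin (q + 1) → Fin r) :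
    ∑ l, letterIncidence F u l * signedLetterIncidence F l u ≠ 0 := by
  rw [sum_letterIncidence_mul]
  simpa [agreement_self] using hF

theorem sum_incidence_mul_self_ne_zero (hq : 0 < q) (hF : (q : F) = 0) (u : Fin (q + 1) → Fin r) :
    ∑ w : PartialWord q (q + 1) r, incidence F u w * weightedIncidence F w u ≠ 0 := by
  rw [sum_incidence_mul_add hF u u (by simp [agreement_self, hq.ne']), if_pos rfl]
  exact pow_ne_zero _ (neg_ne_zero.2 one_ne_zero)

theorem sum_letterIncidence_mul_eq_zero {s : ℕ} {u v : Fin s → Fin r}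
    (h : (agreement u v).card = 1) :
    ∑ l, letterIncidence F u l * signedLetterIncidence F l v = 0 := by
  rw [sum_letterIncidence_mul, h, Nat.cast_one, sub_self]

end

/-! ### The two families of networks and the choice of `q` -/

/-- Networks that are linearly solvable exactly over the fields in which `q` vanishes. -/
theorem exists_networks_of_cast_eq_zero {q : ℕ} (hq : 0 < q) :
    ∃ N : ℕ → Network, ∀ (F : Type u) [Field F] (K : ℕ),
      ((q : F) = 0 → (N K).LinearlySolvable F) ∧
      ((q : F) ≠ 0 → ¬ (N K).LinearlySolvable F ∧
        (N K).linearCapacity F ≤ ((K + 1 : ℕ) : ℝ≥0∞)⁻¹) := by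
  refine ⟨fun K => indexNetwork (Fin (q + 1) → Fin (alphabetSize q K))
    (PartialWord q (q + 1) (alphabetSize q K)) fun u v => (agreement u v).card = 1,
    fun F _ K => ⟨fun hF => ?_, fun hF => ?_⟩⟩
  · refine indexNetwork.linearlySolvable (incidence F) (weightedIncidence F)
      (fun u => ?_) (sum_incidence_mul_self_ne_zero hq hF) fun u v huv h => ?_
    · simp [agreement_self, hq.ne']
    · rw [sum_incidence_mul_add hF u v h, if_neg huv]
  · exact indexNetwork.linearCapacity_le (letterIncidence F) (signedLetterIncidence F)
      (sum_letterIncidence_mul_self_ne_zero hF) (fun u v h => sum_letterIncidence_mul_eq_zero h)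
      (card_mul_card_mul_lt hq K)

/-- Networks that are linearly solvable exactly over the fields in which `q` does not vanish. -/
theorem exists_networks_of_cast_ne_zero {q : ℕ} (hq : 0 < q) :
    ∃ N : ℕ → Network, ∀ (F : Type u) [Field F] (K : ℕ),
      ((q : F) ≠ 0 → (N K).LinearlySolvable F) ∧
      ((q : F) = 0 → ¬ (N K).LinearlySolvable F ∧
        (N K).linearCapacity F ≤ ((K + 1 : ℕ) : ℝ≥0∞)⁻¹) := by
  refine ⟨fun K => indexNetwork (Fin (q + 1) → Fin (alphabetSize q K))
    (Letter (q + 1) (alphabetSize q K)) fun u v => (agreement u v).card ≠ 1 ∧ u ≠ v,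
    fun F _ K => ⟨fun hF => ?_, fun hF => ?_⟩⟩
  · refine indexNetwork.linearlySolvable (letterIncidence F) (signedLetterIncidence F)
      (fun u h => h.2 rfl) (sum_letterIncidence_mul_self_ne_zero hF) fun u v huv h => ?_
    exact sum_letterIncidence_mul_eq_zero (by tauto)
  · refine indexNetwork.linearCapacity_le (incidence F) (weightedIncidence F)
      (sum_incidence_mul_self_ne_zero hq hF) (fun u v h => ?_) ?_
    · rw [sum_incidence_mul_add hF u v h.1, if_neg h.2]
    · rw [mul_comm (Fintype.card _)]
      exact card_mul_card_mul_lt hq K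

theorem cast_prod_eq_zero_iff {F : Type*} [Field F] [Finite F] (s : Finset ℕ)
    (hs : ∀ p ∈ s, p.Prime) : ((∏ p ∈ s, p : ℕ) : F) = 0 ↔ ringChar F ∈ s := by
  have hF : (ringChar F).Prime := CharP.char_is_prime F _
  rw [ringChar.spec, hF.prime.dvd_finsetProd_iff]
  constructor
  · rintro ⟨p, hp, h⟩
    rwa [(Nat.prime_dvd_prime_iff_eq hF (hs p hp)).1 h]
  · exact fun h => ⟨_, h, dvd_rfl⟩

theorem mainTheorem4 (P : Set ℕ) (hprime : ∀ p ∈ P, p.Prime)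
    (hP : P.Finite ∨ ({p : ℕ | p.Prime} \ P).Finite) :
    ∃ N : ℕ → Network, ∀ (F : Type u) [Field F] [Finite F],
      (∀ k : ℕ, (N k).LinearlySolvable F ↔ ringChar F ∈ P) ∧
      (ringChar F ∉ P →
        Filter.Tendsto (fun k => (N k).linearCapacity F) Filter.atTop (nhds 0)) := by
  suffices h : ∃ N : ℕ → Network, ∀ (F : Type u) [Field F] [Finite F] (K : ℕ),
      (ringChar F ∈ P → (N K).LinearlySolvable F) ∧
      (ringChar F ∉ P → ¬ (N K).LinearlySolvable F ∧
        (N K).linearCapacity F ≤ ((K + 1 : ℕ) : ℝ≥0∞)⁻¹) by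
    obtain ⟨N, hN⟩ := h
    refine ⟨N, fun F _ _ => ⟨fun k => ⟨fun h => ?_, (hN F k).1⟩, fun h => ?_⟩⟩
    · by_contra h'
      exact ((hN F k).2 h').1 h
    · exact tendsto_of_tendsto_of_tendsto_of_le_of_le tendsto_const_nhds
        (ENNReal.tendsto_inv_nat_nhds_zero.comp (Filter.tendsto_add_atTop_nat 1))
        (fun _ => zero_le) fun k => ((hN F k).2 h).2
  rcases hP with hP | hP
  · have hs : ∀ p ∈ hP.toFinset, p.Prime := fun p hp => hprime p (hP.mem_toFinset.1 hp)
    -- `q` is the product of the primes in `P`, so it vanishes in `F` exactly when the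
    -- characteristic is in `P`.
    obtain ⟨N, hN⟩ := exists_networks_of_cast_eq_zero (Finset.prod_pos fun p hp => (hs p hp).pos)
    refine ⟨N, fun F _ _ K => ?_⟩
    have h := hN F K
    rwa [Ne, cast_prod_eq_zero_iff _ hs, hP.mem_toFinset] at h
  · have hs : ∀ p ∈ hP.toFinset, p.Prime := fun p hp => (hP.mem_toFinset.1 hp).1
    -- Now `q` is the product of the primes outside `P`.
    obtain ⟨N, hN⟩ := exists_networks_of_cast_ne_zero (Finset.prod_pos fun p hp => (hs p hp).pos)
    refine ⟨N, fun F _ _ K => ?_⟩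
    have hF : (ringChar F).Prime := CharP.char_is_prime F _
    have h := hN F K
    rw [Ne, cast_prod_eq_zero_iff _ hs, hP.mem_toFinset] at h
    simpa [hF] using h
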